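/- Let $X$ be a Hausdorff topological vector space over $\mathbb C$ (not assumed locally convex) and let $K\colon X\to X$ be a compact linear operator, i.e. $K$ maps some zero neighbourhood into a set with compact closure. Then $$r(K)\le|\sigma(K)|,\qquad |\sigma(K)|=\sup\{|\lambda| : \lambda\in\sigma(K)\},$$ for each of the following spectral radii $r$ and each of the following spectra $\sigma$ (so 16 inequalities in all). Radii lie in $[0,\infty]$, with $\inf\emptyset=\infty$ and $\sup\emptyset=0$. A linear operator $T\colon X\to X$ is bb-bounded if it maps bounded sets to bounded sets, nb-bounded if it maps some zero neighbourhood to a bounded set, and nn-bounded if there is a base $\mathcal N_0$ of zero neighbourhoods such that for every $U\in\mathcal N_0$ there is $\alpha>0$ with $T(U)\subseteq\alpha U$. Here and below, bases of zero neighbourhoods consist of balanced sets and are closed under multiplication by nonzero scalars. Spectra: $\sigma^{bb}(T)$, $\sigma^{c}(T)$, $\sigma^{nn}(T)$, $\sigma^{nb}(T)$ are the sets of those $\lambda\in\mathbb C$ for which $\lambda I-T$ has no two-sided linear inverse that is, respectively, bb-bounded; continuous; nn-bounded; of the form $\alpha I+S$ with $\alpha\in\mathbb C$ and $S$ nb-bounded.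 Radii: $r_{bb}(T)$, $r_{c}(T)$, $r_{nn}(T)$, $r_{nb}(T)$ are the infima of those $\nu>0$ for which the operators $S_n=T^n/\nu^n$ tend to zero, respectively, in the following sense: - uniformly on every bounded set; - equicontinuously: for every zero neighbourhood $V$ there is a zero neighbourhood $U$ such that for every $\varepsilon>0$ one has $S_n(U)\subseteq\varepsilon V$ for all large $n$; - for some base $\mathcal N_0$ of zero neighbourhoods, for every $U\in\mathcal N_0$ and every $\varepsilon>0$ one has $S_n(U)\subseteq\varepsilon U$ for all large $n$; - uniformly on some zero neighbourhood. -/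

import Mathlib

open scoped Topology Pointwise ENNReal

namespace TVSOperator

/-- The four classes of operators: bb-bounded (bounded sets go to bounded sets), continuous,
nn-bounded, and nb-bounded (some zero neighbourhood goes to a bounded set). -/
inductive OpClass where
  | bb
  | c
  | nn
  | nb

section

variable {X : Type*} [AddCommGroup X] [Module ℂ X] [TopologicalSpace X]

/-- A base `N` of zero neighbourhoods consisting of balanced sets and closed under multiplication
by nonzero scalars. -/
structure IsZeroBase (N : Set (Set X)) : Prop where
  mem_nhds : ∀ V ∈ N, V ∈ 𝓝 (0 : X)
  exists_subset : ∀ W ∈ 𝓝 (0 : X), ∃ V ∈ N, V ⊆ W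
  balanced : ∀ V ∈ N, Balanced ℂ V
  inter : ∀ V₁ ∈ N, ∀ V₂ ∈ N, ∃ V ∈ N, V ⊆ V₁ ∩ V₂
  add : ∀ V ∈ N, ∃ U ∈ N, U + U ⊆ V
  smul : ∀ V ∈ N, ∀ a : ℂ, a ≠ 0 → a • V ∈ N

/-- `T` maps every bounded set to a bounded set. -/
def IsBBBounded (T : X →ₗ[ℂ] X) : Prop :=
  ∀ A : Set X, Bornology.IsVonNBounded ℂ A → Bornology.IsVonNBounded ℂ (T '' A)

/-- There is a base of zero neighbourhoods each member of which is mapped by `T` into a positive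
multiple of itself. -/
def IsNNBounded (T : X →ₗ[ℂ] X) : Prop :=
  ∃ N : Set (Set X), IsZeroBase N ∧ ∀ U ∈ N, ∃ a : ℝ, 0 < a ∧ T '' U ⊆ (a : ℂ) • U

/-- `T` maps some zero neighbourhood to a bounded set. -/
def IsNBBounded (T : X →ₗ[ℂ] X) : Prop :=
  ∃ U ∈ 𝓝 (0 : X), Bornology.IsVonNBounded ℂ (T '' U)

/-- The operators that are allowed as resolvents in the class `i`: the operators of the class
itself, except that for nb-bounded operators the unitalization of the algebra is used, that is,
the operators `a • 1 + S` with `a` a scalar and `S` nb-bounded. -/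
def IsAdmissibleInverse : OpClass → (X →ₗ[ℂ] X) → Prop
  | .bb, R => IsBBBounded R
  | .c, R => Continuous R
  | .nn, R => IsNNBounded R
  | .nb, R => ∃ (a : ℂ) (S : X →ₗ[ℂ] X), IsNBBounded S ∧ R = a • LinearMap.id + S

/-- The resolvent set `ρⁱ(T)`: all `z` for which `z I - T` has a two-sided inverse that is
admissible for the class `i`. -/
def resolventSet (i : OpClass) (T : X →ₗ[ℂ] X) : Set ℂ :=
  {z | ∃ R : X →ₗ[ℂ] X,
    R ∘ₗ (z • LinearMap.id - T) = LinearMap.id ∧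
    (z • LinearMap.id - T) ∘ₗ R = LinearMap.id ∧
    IsAdmissibleInverse i R}

/-- The spectrum `σⁱ(T)`, the complement of `ρⁱ(T)`. -/
def spectrum (i : OpClass) (T : X →ₗ[ℂ] X) : Set ℂ :=
  (resolventSet i T)ᶜ

/-- The sequence `S` tends to zero uniformly on `A`. -/
def TendsToZeroUniformlyOn (S : ℕ → X →ₗ[ℂ] X) (A : Set X) : Prop :=
  ∀ V ∈ 𝓝 (0 : X), ∃ n₀ : ℕ, ∀ n > n₀, S n '' A ⊆ V

/-- Convergence to zero of a sequence of operators in the sense of each class: uniformly on every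
bounded set; equicontinuously; in the sense of nn-convergence; uniformly on some zero
neighbourhood. -/
def TendsToZero : OpClass → (ℕ → X →ₗ[ℂ] X) → Prop
  | .bb, S => ∀ A : Set X, Bornology.IsVonNBounded ℂ A → TendsToZeroUniformlyOn S A
  | .c, S => ∀ V ∈ 𝓝 (0 : X), ∃ U ∈ 𝓝 (0 : X), ∀ ε : ℝ, 0 < ε →
      ∃ n₀ : ℕ, ∀ n > n₀, S n '' U ⊆ (ε : ℂ) • V
  | .nn, S => ∃ N : Set (Set X), IsZeroBase N ∧ ∀ U ∈ N, ∀ ε : ℝ, 0 < ε →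
      ∃ n₀ : ℕ, ∀ n > n₀, S n '' U ⊆ (ε : ℂ) • U
  | .nb, S => ∃ U ∈ 𝓝 (0 : X), TendsToZeroUniformlyOn S U

/-- The spectral radius `rᵢ(T) = inf {ν > 0 | Tⁿ / νⁿ → 0 in the sense of the class i}`, with
values in `[0, ∞]` and `inf ∅ = ∞`. -/
noncomputable def spectralRadius (i : OpClass) (T : X →ₗ[ℂ] X) : ℝ≥0∞ :=
  sInf {r : ℝ≥0∞ | ∃ ν : ℝ, 0 < ν ∧ TendsToZero i (fun n => ((ν : ℂ) ^ n)⁻¹ • T ^ n) ∧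
    r = ENNReal.ofReal ν}

end

/-- The geometrical radius `sup {|z| | z ∈ s}` of a set of complex numbers, with values in
`[0, ∞]` and `sup ∅ = 0`. -/
noncomputable def geometricRadius (s : Set ℂ) : ℝ≥0∞ :=
  ⨆ z ∈ s, ‖z‖ₑ

end TVSOperator

/-!
After rescaling, the point is that a compact operator `T` without eigenvalues in `1 ≤ |z|` has
powers that are jointly bounded on a zero neighbourhood.

If the powers of `T` are not jointly bounded on a zero neighbourhood `U` with relatively compact
image, then there are arbitrarily long orbit segments inside a fixed compact set that end outside
`U`. By compactness they accumulate at an infinite backward orbit `⋯ ↦ z₂ ↦ z₁ ↦ z₀ ≠ 0` with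
bounded range. On the space of all bounded backward orbits `T` is inverse to the shift, so an
eigenvector of the shift is a geometric sequence and yields an eigenvalue of `T` of modulus at
least `1`.

The shift has an eigenvector because the space of bounded backward orbits is finite-dimensional,
which is seen by counting, as local convexity and hence duality are not available. The relatively
compact set `4 T(U)` is covered by `N` small translates, so `N ^ J` pieces control the first `J`
iterates of `4 T` on `U`. Among `2 ^ (J d)` combinations of `d` orbits with coefficients in
`{0, 1, …, 2 ^ J - 1} / 2 ^ J`, where `N < 2 ^ d`, two lie in the same piece. Their difference gives
an integer combination of the orbits of size `O(2 ^ (-J))`, which for large `J` contradicts linear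
independence.
-/

namespace TVSOperator

open Filter Bornology Set
open scoped Finset

section Pigeonhole

variable {X ι : Type*} [AddCommGroup X]

theorem exists_ne_forall_iterate_sub_mem {A : X →+ X} {U V C : Set X} {t : Finset X}
    (hAU : MapsTo A U C) (hC : C ⊆ ⋃ g ∈ t, (g + ·) ⁻¹' V)
    (hVU : ∀ x ∈ V, ∀ y ∈ V, x - y ∈ U) (J : ℕ) (f : ι → X) (s : Finset ι)
    (hs : #t ^ J < #s) (hf : ∀ a ∈ s, ∀ b ∈ s, f a - f b ∈ U) :
    ∃ a ∈ s, ∃ b ∈ s, a ≠ b ∧ ∀ i ≤ J, A^[i] (f a - f b) ∈ U := by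
  classical
  induction J generalizing f s with
  | zero =>
    obtain ⟨a, ha, b, hb, hab⟩ := Finset.one_lt_card.1 (by simpa using hs)
    exact ⟨a, ha, b, hb, hab, by simpa using hf a ha b hb⟩
  | succ J ih =>
    have hcenter : ∀ x ∈ C, ∃ g ∈ t, g + x ∈ V := fun x hx => by simpa using hC hx
    choose! center hcenter_mem hcenter_add using hcenter
    obtain ⟨a₀, ha₀⟩ : s.Nonempty := Finset.card_pos.1 ((Nat.zero_le _).trans_lt hs)
    have hgC : ∀ a ∈ s, A (f a - f a₀) ∈ C := fun a ha => hAU (hf a ha a₀ ha₀)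
    obtain ⟨y, -, hy⟩ := Finset.exists_lt_card_fiber_of_mul_lt_card_of_maps_to
      (f := fun a => center (A (f a - f a₀))) (fun a ha => hcenter_mem _ (hgC a ha))
      (by rwa [← pow_succ'])
    have hsub : ∀ a b, A (f a - f a₀) - A (f b - f a₀) = A (f a - f b) := fun a b => by
      rw [← map_sub, sub_sub_sub_cancel_right]
    obtain ⟨a, ha, b, hb, hab, h⟩ := ih (fun a => A (f a - f a₀)) _ hy fun a ha b hb => by
      obtain ⟨ha, hay⟩ := Finset.mem_filter.1 ha
      obtain ⟨hb, hby⟩ := Finset.mem_filter.1 hb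
      have hVa := hcenter_add _ (hgC a ha)
      have hVb := hcenter_add _ (hgC b hb)
      rw [hay] at hVa
      rw [hby] at hVb
      simpa only [add_sub_add_left_eq_sub] using hVU _ hVa _ hVb
    have has := Finset.mem_of_mem_filter a ha
    have hbs := Finset.mem_of_mem_filter b hb
    refine ⟨a, has, b, hbs, hab, fun i hi => ?_⟩
    cases i with
    | zero => exact hf a has b hbs
    | succ i =>
      rw [Function.iterate_succ_apply, ← hsub]
      exact h i (by lia)

end Pigeonhole

section BackwardOrbit

variable {X : Type*}

theorem iterate_backwardOrbit {T : X → X} {z : ℕ → X} (hz : ∀ j, T (z (j + 1)) = z j)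
    (i j : ℕ) : T^[i] (z (j + i)) = z j := by
  induction i with
  | zero => rfl
  | succ i ih => rw [Function.iterate_succ_apply, ← add_assoc, hz, ih]

theorem exists_backwardOrbit_of_isCompact [TopologicalSpace X] [T2Space X] {T : X → X}
    (hT : Continuous T) {C F : Set X} (hC : IsCompact C) (hF : IsClosed F)
    (h : ∀ n, ∃ x, (∀ k ≤ n, T^[k] x ∈ C) ∧ T^[n] x ∈ F) :
    ∃ z : ℕ → X, (∀ j, z j ∈ C) ∧ (∀ j, T (z (j + 1)) = z j) ∧ z 0 ∈ F := by
  let orbits (n : ℕ) : Set (ℕ → X) :=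
    univ.pi (fun _ => C) ∩ {z | z 0 ∈ F ∧ ∀ j < n, T (z (j + 1)) = z j}
  have hcompact : IsCompact (univ.pi fun _ : ℕ => C) := isCompact_univ_pi fun _ => hC
  have hclosed (n : ℕ) : IsClosed {z : ℕ → X | z 0 ∈ F ∧ ∀ j < n, T (z (j + 1)) = z j} := by
    simp only [Set.ofPred_and, Set.ofPred_forall]
    exact (hF.preimage (continuous_apply 0)).inter <| isClosed_iInter fun j =>
      isClosed_iInter fun _ => isClosed_eq (hT.comp (continuous_apply _)) (continuous_apply _)
  have hnonempty (n : ℕ) : (orbits n).Nonempty := by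
    obtain ⟨x, hxC, hxF⟩ := h n
    refine ⟨fun j => T^[n - j] x, fun j _ => hxC _ (n.sub_le j), hxF, fun j hj => ?_⟩
    rw [← Function.iterate_succ_apply' T]
    congr 2
    lia
  obtain ⟨z, hz⟩ := IsCompact.nonempty_iInter_of_sequence_nonempty_isCompact_isClosed orbits
    (fun n z hz => ⟨hz.1, hz.2.1, fun j hj => hz.2.2 j (hj.trans n.lt_succ_self)⟩) hnonempty
    (hcompact.inter_right (hclosed 0)) fun n => hcompact.isClosed.inter (hclosed n)
  rw [Set.mem_iInter] at hz
  exact ⟨z, fun j => (hz 0).1 j trivial, fun j => (hz (j + 1)).2.2 j j.lt_succ_self, (hz 0).2.1⟩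

end BackwardOrbit

section VonNBounded

variable {𝕜 X : Type*} [NontriviallyNormedField 𝕜] [AddCommGroup X] [Module 𝕜 X]
  [TopologicalSpace X]

theorem exists_ne_zero_forall_smul_mem {D U : Set X} (hD : IsVonNBounded 𝕜 D)
    (hU : U ∈ 𝓝 (0 : X)) : ∃ c : 𝕜, c ≠ 0 ∧ ∀ x ∈ D, c • x ∈ U := by
  have hDU := (absorbs_iff_eventually_nhdsNE_zero (𝕜 := 𝕜)).1 (hD hU)
  exact (eventually_mem_nhdsWithin.and hDU).exists

variable [ContinuousSMul 𝕜 X]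

theorem isVonNBounded_smul {D : Set X} (hD : IsVonNBounded 𝕜 D) (a : 𝕜) :
    IsVonNBounded 𝕜 (a • D) :=
  hD.image (a • ContinuousLinearMap.id 𝕜 X)

theorem isVonNBounded_balancedHull {D : Set X} (hD : IsVonNBounded 𝕜 D) :
    IsVonNBounded 𝕜 (balancedHull 𝕜 D) := by
  refine (nhds_basis_balanced 𝕜 X).isVonNBounded_iff.2 fun V ⟨hV, hVbal⟩ => ?_
  filter_upwards [hD hV] with c hc
  exact (hVbal.smul c).balancedHull_subset_of_subset hc

end VonNBounded

theorem exists_nhds_forall_sum_intCast_smul_mem_imp_eq_zero {𝕜 E ι : Type*} [RCLike 𝕜]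
    [AddCommGroup E] [Module 𝕜 E] [TopologicalSpace E] [IsTopologicalAddGroup E]
    [ContinuousSMul 𝕜 E] [T2Space E] [Fintype ι] {e : ι → E} (he : LinearIndependent 𝕜 e) :
    ∃ V ∈ 𝓝 (0 : E), ∀ a : ι → ℤ, ∑ i, (a i : 𝕜) • e i ∈ V → a = 0 := by
  have hemb : Topology.IsClosedEmbedding (Fintype.linearCombination 𝕜 e) :=
    LinearMap.isClosedEmbedding_of_injective <| LinearMap.ker_eq_bot.2 <|
      linearIndependent_iff_injective_fintypeLinearCombination.1 he
  have hball : Metric.ball (0 : ι → 𝕜) 1 ∈ comap (Fintype.linearCombination 𝕜 e) (𝓝 0) := by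
    rw [← map_zero (Fintype.linearCombination 𝕜 e), ← hemb.isInducing.nhds_eq_comap]
    exact Metric.ball_mem_nhds 0 one_pos
  obtain ⟨V, hV, hVball⟩ := mem_comap.1 hball
  refine ⟨V, hV, fun a ha => funext fun i => ?_⟩
  have hnorm : ‖fun i => (a i : 𝕜)‖ < 1 := mem_ball_zero_iff.1 (hVball ha)
  have habs : |a i| < 1 := by
    have := (norm_le_pi_norm (fun i => (a i : 𝕜)) i).trans_lt hnorm
    rw [← RCLike.ofReal_intCast, RCLike.norm_ofReal] at this
    exact_mod_cast this
  exact Int.abs_lt_one_iff.1 habs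

section BoundedBackwardOrbits

variable {𝕜 X : Type*} [NontriviallyNormedField 𝕜] [AddCommGroup X] [Module 𝕜 X]
  [TopologicalSpace X] [IsTopologicalAddGroup X] [ContinuousSMul 𝕜 X]

/-- The space of bounded backward orbits `⋯ ↦ z 2 ↦ z 1 ↦ z 0` of a linear operator. Whole
sequences are recorded rather than their end points `z 0`, which makes the shift an inverse of
the operator without any injectivity assumption. -/
def boundedBackwardOrbits (T : X →ₗ[𝕜] X) : Submodule 𝕜 (ℕ → X) where
  carrier := {z | (∀ j, T (z (j + 1)) = z j) ∧ IsVonNBounded 𝕜 (range z)}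
  zero_mem' := ⟨fun _ => map_zero T, (isVonNBounded_singleton (0 : X)).subset range_const_subset⟩
  add_mem' := fun {z w} ⟨hz, hzb⟩ ⟨hw, hwb⟩ =>
    ⟨fun j => by simp only [Pi.add_apply, map_add, hz, hw],
      (hzb.add hwb).subset <| range_subset_iff.2 fun j =>
        Set.add_mem_add (mem_range_self j) (mem_range_self j)⟩
  smul_mem' := fun a z ⟨hz, hzb⟩ =>
    ⟨fun j => by simp only [Pi.smul_apply, map_smul, hz],
      (isVonNBounded_smul hzb a).subset <| range_subset_iff.2 fun j =>
        Set.smul_mem_smul_set (mem_range_self j)⟩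

theorem exists_isVonNBounded_forall_sum_smul_mem {T : X →ₗ[𝕜] X} {ι : Type*} [Fintype ι]
    {z : ι → ℕ → X} (hz : ∀ i, z i ∈ boundedBackwardOrbits T) :
    ∃ D : Set X, IsVonNBounded 𝕜 D ∧
      ∀ c : ι → 𝕜, (∀ i, ‖c i‖ ≤ 1) → ∀ j, ∑ i, c i • z i j ∈ D := by
  refine ⟨∑ i, balancedHull 𝕜 (range (z i)),
    Finset.sum_induction _ (IsVonNBounded 𝕜) (fun _ _ => IsVonNBounded.add)
      (isVonNBounded_singleton 0) fun i _ => isVonNBounded_balancedHull (hz i).2,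
    fun c hc j => Set.finsetSum_mem_finsetSum _ _ _ fun i _ => ?_⟩
  exact mem_balancedHull_iff.2 ⟨c i, hc i, z i j, ⟨j, rfl⟩, rfl⟩

theorem exists_hasEigenvalue_one_le_norm [IsAlgClosed 𝕜] [T2Space X] {T : X →ₗ[𝕜] X}
    [FiniteDimensional 𝕜 (boundedBackwardOrbits T)] (hT : boundedBackwardOrbits T ≠ ⊥) :
    ∃ l : 𝕜, Module.End.HasEigenvalue T l ∧ 1 ≤ ‖l‖ := by
  have : Nontrivial (boundedBackwardOrbits T) := Submodule.nontrivial_iff_ne_bot.2 hT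
  let shift : Module.End 𝕜 (boundedBackwardOrbits T) :=
    (LinearMap.funLeft 𝕜 X Nat.succ).restrict fun z hz =>
      ⟨fun j => hz.1 (j + 1), hz.2.subset (range_comp_subset_range _ z)⟩
  obtain ⟨μ, hμ⟩ := Module.End.exists_eigenvalue shift
  obtain ⟨⟨z, hz, hzb⟩, hzμ⟩ := hμ.exists_hasEigenvector
  have hsucc (j : ℕ) : z (j + 1) = μ • z j :=
    congrFun (congrArg Subtype.val hzμ.apply_eq_smul) j
  have hgeom (j : ℕ) : z j = μ ^ j • z 0 := by
    induction j with
    | zero => rw [pow_zero, one_smul]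
    | succ j ih => rw [hsucc, ih, smul_smul, pow_succ']
  have hz0 : z 0 ≠ 0 := fun h0 => hzμ.2 <| Subtype.ext <| funext fun j =>
    (hgeom j).trans (by rw [h0, smul_zero]; rfl)
  have hTz : μ • T (z 0) = z 0 := by rw [← map_smul, ← hsucc, hz]
  have hμ0 : μ ≠ 0 := by
    rintro rfl
    exact hz0 (by rw [← hTz, zero_smul])
  refine ⟨μ⁻¹, Module.End.hasEigenvalue_of_hasEigenvector
    ⟨Module.End.mem_eigenspace_iff.2 ((eq_inv_smul_iff₀ hμ0).2 hTz), hz0⟩, ?_⟩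
  rw [norm_inv, one_le_inv₀ (norm_pos_iff.2 hμ0)]
  by_contra! hlt
  have hpow : Tendsto (fun j : ℕ => μ⁻¹ ^ j) atTop (𝓝 0) :=
    tendsto_pow_atTop_nhds_zero_of_norm_lt_one (by rw [norm_inv]; exact inv_lt_one_of_one_lt₀ hlt)
  have hlim := hzb.smul_tendsto_zero (Eventually.of_forall mem_range_self) hpow
  refine hz0 (tendsto_nhds_unique (tendsto_const_nhds.congr fun j => ?_) hlim)
  rw [Pi.smul_apply', hgeom j, inv_pow, inv_smul_smul₀ (pow_ne_zero j hμ0)]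

end BoundedBackwardOrbits

section Finiteness

variable {𝕜 X ι : Type*} [RCLike 𝕜] [AddCommGroup X] [Module 𝕜 X]

theorem norm_natCast_sub_natCast_div_le_one {m : ℕ} (k k' : Fin m) :
    ‖((k : 𝕜) - (k' : 𝕜)) / m‖ ≤ 1 := by
  have hm : (0 : ℝ) < m := by exact_mod_cast k.pos
  have hk : (k : ℝ) < m := by exact_mod_cast k.is_lt
  have hk' : (k' : ℝ) < m := by exact_mod_cast k'.is_lt
  have hcast : (k : 𝕜) - (k' : 𝕜) = ((k - k' : ℝ) : 𝕜) := by push_cast; rfl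
  rw [norm_div, RCLike.norm_natCast, div_le_one hm, hcast, RCLike.norm_ofReal, abs_le]
  constructor <;> linarith [(k : ℕ).cast_nonneg (α := ℝ), (k' : ℕ).cast_nonneg (α := ℝ)]

theorem exists_int_ne_zero_forall_iterate_sum_mem [Fintype ι] {A : X →+ X} {U V C : Set X}
    {t : Finset X} (hAU : MapsTo A U C) (hC : C ⊆ ⋃ g ∈ t, (g + ·) ⁻¹' V)
    (hVU : ∀ x ∈ V, ∀ y ∈ V, x - y ∈ U) {J m : ℕ} (hm : #t ^ J < m ^ Fintype.card ι) {w : ι → X}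
    (hw : ∀ c : ι → 𝕜, (∀ i, ‖c i‖ ≤ 1) → ∑ i, c i • w i ∈ U) :
    ∃ a : ι → ℤ, a ≠ 0 ∧ ∀ n ≤ J, A^[n] (∑ i, ((a i : 𝕜) / m) • w i) ∈ U := by
  classical
  let grid (k : ι → Fin m) : X := ∑ i, ((k i : 𝕜) / m) • w i
  have hgrid (k k' : ι → Fin m) :
      grid k - grid k' = ∑ i, (((k i : 𝕜) - (k' i : 𝕜)) / m) • w i := by
    simp only [grid, ← Finset.sum_sub_distrib, ← sub_smul, ← sub_div]
  obtain ⟨k, -, k', -, hne, hkk'⟩ := exists_ne_forall_iterate_sub_mem hAU hC hVU J grid Finset.univ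
    (by simpa using hm) fun k _ k' _ => by
      rw [hgrid]
      exact hw _ fun i => norm_natCast_sub_natCast_div_le_one (k i) (k' i)
  refine ⟨fun i => (k i : ℤ) - k' i, fun h0 => hne (funext fun i => Fin.ext ?_), fun n hn => ?_⟩
  · exact_mod_cast sub_eq_zero.1 (congrFun h0 i)
  · simpa only [hgrid, Int.cast_sub, Int.cast_natCast] using hkk' n hn

theorem exists_int_ne_zero_forall_smul_sum_mem [Fintype ι] {T : X →ₗ[𝕜] X} {U V C : Set X}
    {t : Finset X} (hTU : MapsTo T U C) (ht : (4 : 𝕜) • C ⊆ ⋃ g ∈ t, (g + ·) ⁻¹' V)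
    (hVU : ∀ x ∈ V, ∀ y ∈ V, x - y ∈ U) (htι : #t < 2 ^ Fintype.card ι) {z : ι → ℕ → X}
    (hz : ∀ i j, T (z i (j + 1)) = z i j)
    (hzU : ∀ c : ι → 𝕜, (∀ i, ‖c i‖ ≤ 1) → ∀ j, ∑ i, c i • z i j ∈ U) {J : ℕ} (hJ : J ≠ 0) :
    ∃ a : ι → ℤ, a ≠ 0 ∧ ∀ l < J, (2 ^ J / 4 ^ (l + 1) : 𝕜) • ∑ i, (a i : 𝕜) • z i l ∈ C := by
  have hcard : #t ^ J < (2 ^ J) ^ Fintype.card ι := by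
    rw [← pow_mul, mul_comm, pow_mul]
    exact Nat.pow_lt_pow_left htι hJ
  obtain ⟨a, ha, haU⟩ := exists_int_ne_zero_forall_iterate_sum_mem
    (A := ((4 : 𝕜) • T).toAddMonoidHom) (fun x hx => Set.smul_mem_smul_set (hTU hx)) ht hVU hcard
    fun c hc => hzU c hc J
  refine ⟨a, ha, fun l hl => ?_⟩
  obtain ⟨n, rfl⟩ : ∃ n, J = l + 1 + n := Nat.exists_eq_add_of_le hl
  have hiter (x : X) : ((4 : 𝕜) • T).toAddMonoidHom^[n] x = (4 : 𝕜) ^ n • T^[n] x := by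
    have := Module.End.pow_apply ((4 : 𝕜) • T) n x
    rw [smul_pow, LinearMap.smul_apply, Module.End.pow_apply] at this
    exact this.symm
  let c (i : ι) : 𝕜 := a i / (2 ^ (l + 1 + n) : ℕ)
  have hcomb (j : ℕ) : T (∑ i, c i • z i (j + 1)) = ∑ i, c i • z i j := by
    simp only [map_sum, map_smul, hz]
  have horbit : T^[n] (∑ i, c i • z i (l + 1 + n)) = ∑ i, c i • z i (l + 1) :=
    iterate_backwardOrbit (z := fun j => ∑ i, c i • z i j) hcomb n (l + 1)
  have hmem := hTU (haU n (by lia))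
  rw [hiter, map_smul, horbit, hcomb] at hmem
  have hscale : (2 ^ (l + 1 + n) / 4 ^ (l + 1) : 𝕜) = 4 ^ n / 2 ^ (l + 1 + n) := by
    rw [div_eq_div_iff (by simp) (by simp), ← mul_pow, ← pow_add, add_comm n]
    norm_num
  convert hmem using 1
  simp only [hscale, Finset.smul_sum, smul_smul, c]
  refine Finset.sum_congr rfl fun i _ => congrArg (· • z i l) ?_
  push_cast
  ring

variable [TopologicalSpace X] [IsTopologicalAddGroup X] [ContinuousSMul 𝕜 X] [T2Space X]

theorem two_pow_card_le_of_linearIndependent [Fintype ι] {T : X →ₗ[𝕜] X} {U V C : Set X}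
    {t : Finset X} (hU : U ∈ 𝓝 (0 : X)) (hC : IsCompact C) (hTU : MapsTo T U C)
    (ht : (4 : 𝕜) • C ⊆ ⋃ g ∈ t, (g + ·) ⁻¹' V) (hVU : ∀ x ∈ V, ∀ y ∈ V, x - y ∈ U)
    {z : ι → ℕ → X} (hz : ∀ i, z i ∈ boundedBackwardOrbits T) (hli : LinearIndependent 𝕜 z) :
    2 ^ Fintype.card ι ≤ #t := by
  by_contra! htι
  obtain ⟨D, hD, hzD⟩ := exists_isVonNBounded_forall_sum_smul_mem hz
  obtain ⟨m, hm, hmU⟩ := exists_ne_zero_forall_smul_mem hD hU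
  obtain ⟨W, hW, hWzero⟩ := exists_nhds_forall_sum_intCast_smul_mem_imp_eq_zero
    (𝕜 := 𝕜) (hli.units_smul fun _ => Units.mk0 m hm)
  have hcomb (J : ℕ) := exists_int_ne_zero_forall_smul_sum_mem (z := fun i => m • z i)
    hTU ht hVU htι (fun i => (Submodule.smul_mem _ m (hz i)).1)
    (fun c hc j => by
      simpa only [Pi.smul_apply, smul_comm _ m, ← Finset.smul_sum] using hmU _ (hzD c hc j))
    J.succ_ne_zero
  choose a ha haC using hcomb
  have hlim : Tendsto (fun J => ∑ i, (a J i : 𝕜) • m • z i) atTop (𝓝 0) := by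
    refine tendsto_pi_nhds.2 fun l => ?_
    have hscalar : Tendsto (fun J : ℕ => (4 ^ (l + 1) / 2 ^ (J + 1) : 𝕜)) atTop (𝓝 0) := by
      have hhalf : Tendsto (fun J : ℕ => (2⁻¹ : 𝕜) ^ (J + 1)) atTop (𝓝 0) :=
        (tendsto_pow_atTop_nhds_zero_of_norm_lt_one (by norm_num)).comp (tendsto_add_atTop_nat 1)
      simpa only [mul_zero, inv_pow, div_eq_mul_inv] using hhalf.const_mul ((4 : 𝕜) ^ (l + 1))
    have hmemC : ∀ᶠ J in atTop,
        (2 ^ (J + 1) / 4 ^ (l + 1) : 𝕜) • ∑ i, (a J i : 𝕜) • (m • z i) l ∈ C := by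
      filter_upwards [eventually_ge_atTop l] with J hJ using haC J l (by lia)
    refine ((hC.isVonNBounded 𝕜).smul_tendsto_zero hmemC hscalar).congr fun J => ?_
    rw [Pi.smul_apply', ← inv_div,
      inv_smul_smul₀ (div_ne_zero (by simp) (by simp)),
      Finset.sum_apply]
    rfl
  obtain ⟨J, hJ⟩ := (hlim.eventually hW).exists
  exact ha J (hWzero (a J) hJ)

theorem finiteDimensional_boundedBackwardOrbits {T : X →ₗ[𝕜] X} (hT : IsCompactOperator T) :
    FiniteDimensional 𝕜 (boundedBackwardOrbits T) := by
  obtain ⟨C, hC, hTC⟩ := hT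
  obtain ⟨V, hV, hVU⟩ := exists_nhds_half_neg hTC
  obtain ⟨t, ht⟩ := compact_covered_by_add_left_translates (hC.smul (4 : 𝕜))
    ⟨0, mem_interior_iff_mem_nhds.2 hV⟩
  have hrank : Module.rank 𝕜 (boundedBackwardOrbits T) ≤ (#t : Cardinal) :=
    rank_le fun s hs => by
      have := two_pow_card_le_of_linearIndependent hTC hC (mapsTo_preimage T C) ht hVU
        (fun i : s => i.1.2) (hs.map' (boundedBackwardOrbits T).subtype (Submodule.ker_subtype _))
      rw [Fintype.card_coe] at this
      exact Nat.lt_two_pow_self.le.trans this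
  exact Module.rank_lt_aleph0_iff.1 (hrank.trans_lt Cardinal.natCast_lt_aleph0)

end Finiteness

section PowerBounded

variable {𝕜 X : Type*} [NontriviallyNormedField 𝕜] [AddCommGroup X] [Module 𝕜 X]
  [TopologicalSpace X] [IsTopologicalAddGroup X] [ContinuousSMul 𝕜 X]

theorem absorbs_image_pow {T : X →ₗ[𝕜] X} {U C : Set X} (hU : U ∈ 𝓝 (0 : X))
    (hUbal : Balanced 𝕜 U) (hC : IsCompact C) (hTU : MapsTo T U C) (n : ℕ) :
    Absorbs 𝕜 U ((T ^ n) '' U) := by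
  cases n with
  | zero => simpa using hUbal.absorbs_self
  | succ n =>
    have hT : Continuous T := IsCompactOperator.continuous ⟨C, hC, mem_of_superset hU hTU⟩
    have hCn : IsVonNBounded 𝕜 (T^[n] '' C) := (hC.image (hT.iterate n)).isVonNBounded 𝕜
    refine (hCn hU).mono_right ?_
    rintro _ ⟨x, hx, rfl⟩
    exact ⟨T x, hTU hx, by rw [Module.End.pow_apply, Function.iterate_succ_apply]⟩

theorem exists_orbit_segment_of_forall_exists_smul_pow_notMem {T : X →ₗ[𝕜] X} {U C : Set X}
    (hU : U ∈ 𝓝 (0 : X)) (hUbal : Balanced 𝕜 U) (hC : IsCompact C) (hTU : MapsTo T U C)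
    (h : ∀ c : 𝕜, c ≠ 0 → ∃ n, ∃ x ∈ U, c • (T ^ n) x ∉ U) (n : ℕ) :
    ∃ x, (∀ k ≤ n, T^[k] x ∈ C) ∧ T^[n] x ∉ U := by
  classical
  have hsmall : ∀ᶠ c : 𝕜 in 𝓝[≠] 0, ∀ k ∈ Finset.range (n + 2), MapsTo (c • ·) ((T ^ k) '' U) U :=
    (eventually_all_finset _).2 fun k _ => absorbs_iff_eventually_nhdsNE_zero.1
      (absorbs_image_pow hU hUbal hC hTU k)
  obtain ⟨c, hc0, hc⟩ := (eventually_mem_nhdsWithin.and hsmall).exists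
  obtain ⟨x, hxU, hx⟩ := Nat.find_spec (h c hc0)
  set m := Nat.find (h c hc0)
  have hbelow : ∀ k < m, c • (T ^ k) x ∈ U := fun k hk => by
    by_contra hk'
    exact Nat.find_min (h c hc0) hk ⟨x, hxU, hk'⟩
  have hnm : n + 1 < m := by
    by_contra! hmn
    exact hx (hc m (Finset.mem_range.2 (by lia)) ⟨x, hxU, rfl⟩)
  have hiter (k : ℕ) : T^[k] (c • (T ^ (m - n)) x) = c • (T ^ (k + (m - n))) x := by
    rw [← Module.End.pow_apply, map_smul, pow_add, Module.End.mul_apply]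
  refine ⟨c • (T ^ (m - n)) x, fun k hk => ?_, ?_⟩
  · obtain ⟨p, hp⟩ : ∃ p, k + (m - n) = p + 1 := ⟨k + (m - n) - 1, by lia⟩
    rw [hiter, hp, pow_succ', Module.End.mul_apply, ← map_smul]
    exact hTU (hbelow p (by lia))
  · rwa [hiter, Nat.add_sub_cancel' (by lia)]

theorem isVonNBounded_iUnion_image_pow_of_boundedBackwardOrbits_eq_bot [T2Space X]
    {T : X →ₗ[𝕜] X} {U C : Set X} (hU : U ∈ 𝓝 (0 : X)) (hUbal : Balanced 𝕜 U)
    (hC : IsCompact C) (hTU : MapsTo T U C) (hbot : boundedBackwardOrbits T = ⊥) :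
    IsVonNBounded 𝕜 (⋃ n : ℕ, (T ^ (n + 1)) '' U) := by
  obtain ⟨c, hc0, hc⟩ : ∃ c : 𝕜, c ≠ 0 ∧ ∀ n, ∀ x ∈ U, c • (T ^ n) x ∈ U := by
    by_contra! h
    have hsegment := exists_orbit_segment_of_forall_exists_smul_pow_notMem hU hUbal hC hTU h
    have hT : Continuous T := IsCompactOperator.continuous ⟨C, hC, mem_of_superset hU hTU⟩
    obtain ⟨z, hzC, hz, hz0⟩ := exists_backwardOrbit_of_isCompact hT hC
      isOpen_interior.isClosed_compl fun n =>
        (hsegment n).imp fun _ hx => ⟨hx.1, fun hmem => hx.2 (interior_subset hmem)⟩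
    have hzmem : z ∈ boundedBackwardOrbits T :=
      ⟨hz, (hC.isVonNBounded 𝕜).subset (range_subset_iff.2 hzC)⟩
    rw [hbot, Submodule.mem_bot] at hzmem
    exact hz0 (by rw [hzmem]; exact mem_interior_iff_mem_nhds.2 hU)
  refine (isVonNBounded_smul (hC.isVonNBounded 𝕜) c⁻¹).subset (iUnion_subset fun n => ?_)
  rintro _ ⟨x, hx, rfl⟩
  rw [Set.mem_smul_set_iff_inv_smul_mem₀ (inv_ne_zero hc0), inv_inv, pow_succ',
    Module.End.mul_apply, ← map_smul]
  exact hTU (hc n x hx)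

end PowerBounded

section Convergence

variable {X : Type*} [AddCommGroup X] [Module ℂ X] [TopologicalSpace X]

theorem TendsToZeroUniformlyOn.of_subset_smul [ContinuousSMul ℂ X] {S : ℕ → X →ₗ[ℂ] X}
    {A B : Set X} (hS : TendsToZeroUniformlyOn S A) {a : ℂ} (hBA : B ⊆ a • A) :
    TendsToZeroUniformlyOn S B := by
  intro V hV
  obtain ⟨n₀, hn₀⟩ := hS ((a • ·) ⁻¹' V)
    ((continuous_const_smul a).continuousAt.preimage_mem_nhds (by rwa [smul_zero]))
  refine ⟨n₀, fun n hn => ?_⟩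
  rintro _ ⟨x, hx, rfl⟩
  obtain ⟨y, hy, rfl⟩ := hBA hx
  simpa using hn₀ n hn ⟨y, hy, rfl⟩

theorem TendsToZeroUniformlyOn.exists_image_subset_smul [ContinuousSMul ℂ X]
    {S : ℕ → X →ₗ[ℂ] X} {A V : Set X} (hS : TendsToZeroUniformlyOn S A) (hV : V ∈ 𝓝 (0 : X))
    {ε : ℝ} (hε : 0 < ε) : ∃ n₀ : ℕ, ∀ n > n₀, S n '' A ⊆ (ε : ℂ) • V :=
  hS _ ((set_smul_mem_nhds_zero_iff (by exact_mod_cast hε.ne')).2 hV)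

/-- The balanced zero neighbourhoods that are contained in a multiple of `U`. If `U` is a zero
neighbourhood, they form a base on whose members uniform convergence on `U` is inherited. -/
def subordinateBase (U : Set X) : Set (Set X) :=
  {W | W ∈ 𝓝 0 ∧ Balanced ℂ W ∧ ∃ a : ℂ, W ⊆ a • U}

theorem balancedCore_mem_subordinateBase [ContinuousSMul ℂ X] {U V : Set X}
    (hV : V ∈ 𝓝 (0 : X)) {a : ℂ} (hVU : V ⊆ a • U) : balancedCore ℂ V ∈ subordinateBase U :=
  ⟨balancedCore_mem_nhds_zero hV, balancedCore_balanced V, a, (balancedCore_subset V).trans hVU⟩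

theorem isZeroBase_subordinateBase [ContinuousAdd X] [ContinuousSMul ℂ X] {U : Set X}
    (hU : U ∈ 𝓝 (0 : X)) : IsZeroBase (subordinateBase U) where
  mem_nhds _ hV := hV.1
  exists_subset W hW :=
    ⟨balancedCore ℂ (W ∩ U), balancedCore_mem_subordinateBase (a := 1) (inter_mem hW hU)
      (by rw [one_smul]; exact inter_subset_right),
      (balancedCore_subset _).trans inter_subset_left⟩
  balanced _ hV := hV.2.1
  inter := by
    rintro V₁ ⟨hV₁, -, a, hV₁U⟩ V₂ ⟨hV₂, -, -⟩
    exact ⟨balancedCore ℂ (V₁ ∩ V₂), balancedCore_mem_subordinateBase (inter_mem hV₁ hV₂)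
      (inter_subset_left.trans hV₁U), balancedCore_subset _⟩
  add := by
    rintro V ⟨hV, -, a, hVU⟩
    obtain ⟨W, hW, hWV⟩ := exists_nhds_zero_half hV
    refine ⟨balancedCore ℂ (W ∩ V), balancedCore_mem_subordinateBase (inter_mem hW hV)
      (inter_subset_right.trans hVU), add_subset_iff.2 fun x hx y hy => ?_⟩
    exact hWV x (balancedCore_subset _ hx).1 y (balancedCore_subset _ hy).1
  smul := by
    rintro V ⟨hV, hVbal, a, hVU⟩ b hb
    exact ⟨(set_smul_mem_nhds_zero_iff hb).2 hV, hVbal.smul b, b * a,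
      by rw [mul_smul]; exact smul_set_mono hVU⟩

theorem TendsToZero.of_nb [ContinuousAdd X] [ContinuousSMul ℂ X] {S : ℕ → X →ₗ[ℂ] X}
    (hS : TendsToZero .nb S) (i : OpClass) : TendsToZero i S := by
  obtain ⟨U, hU, hSU⟩ := hS
  cases i with
  | bb =>
    intro A hA
    obtain ⟨a, hAU⟩ := (hA hU).eventually.exists
    exact hSU.of_subset_smul hAU
  | c => exact fun V hV => ⟨U, hU, fun ε hε => hSU.exists_image_subset_smul hV hε⟩
  | nn =>
    refine ⟨subordinateBase U, isZeroBase_subordinateBase hU, ?_⟩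
    rintro W ⟨hW, -, a, hWU⟩ ε hε
    exact (hSU.of_subset_smul hWU).exists_image_subset_smul hW hε
  | nb => exact ⟨U, hU, hSU⟩

theorem tendsToZeroUniformlyOn_smul_pow {T : X →ₗ[ℂ] X} {U : Set X}
    (hTU : IsVonNBounded ℂ (⋃ n : ℕ, (T ^ (n + 1)) '' U)) {c : ℂ} (hc : ‖c‖ < 1) :
    TendsToZeroUniformlyOn (fun n => c ^ n • T ^ n) U := by
  intro V hV
  have habsorb := (absorbs_iff_eventually_nhds_zero (mem_of_mem_nhds hV)).1 (hTU hV)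
  obtain ⟨n₀, hn₀⟩ := eventually_atTop.1
    ((tendsto_pow_atTop_nhds_zero_of_norm_lt_one hc).eventually habsorb)
  refine ⟨n₀, fun n hn => ?_⟩
  obtain ⟨m, rfl⟩ := Nat.exists_eq_add_one_of_ne_zero (Nat.ne_zero_of_lt hn)
  rintro _ ⟨x, hx, rfl⟩
  exact hn₀ _ hn.le (mem_iUnion.2 ⟨m, x, hx, rfl⟩)

end Convergence

section SpectralRadius

variable {X : Type*} [AddCommGroup X] [Module ℂ X] [TopologicalSpace X]

theorem mem_spectrum_of_hasEigenvalue {T : X →ₗ[ℂ] X} {l : ℂ}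
    (hl : Module.End.HasEigenvalue T l) (i : OpClass) : l ∈ spectrum i T := by
  obtain ⟨y, hy⟩ := hl.exists_hasEigenvector
  rintro ⟨R, hR, -, -⟩
  have hRy : R (l • y - T y) = y := LinearMap.congr_fun hR y
  rw [hy.apply_eq_smul, sub_self, map_zero] at hRy
  exact hy.2 hRy.symm

theorem enorm_le_geometricRadius {s : Set ℂ} {z : ℂ} (hz : z ∈ s) : ‖z‖ₑ ≤ geometricRadius s :=
  le_iSup₂ (f := fun z (_ : z ∈ s) => ‖z‖ₑ) z hz

theorem spectralRadius_le_ofReal {i : OpClass} {T : X →ₗ[ℂ] X} {ν : ℝ} (hν : 0 < ν)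
    (h : TendsToZero i fun n => ((ν : ℂ) ^ n)⁻¹ • T ^ n) :
    spectralRadius i T ≤ ENNReal.ofReal ν :=
  sInf_le ⟨ν, hν, h, rfl⟩

variable [IsTopologicalAddGroup X] [ContinuousSMul ℂ X] [T2Space X]

theorem exists_nhds_isVonNBounded_iUnion_image_pow {T : X →ₗ[ℂ] X} (hT : IsCompactOperator T)
    (h : ∀ l, Module.End.HasEigenvalue T l → ‖l‖ < 1) :
    ∃ U ∈ 𝓝 (0 : X), IsVonNBounded ℂ (⋃ n : ℕ, (T ^ (n + 1)) '' U) := by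
  have hbot : boundedBackwardOrbits T = ⊥ := by
    have := finiteDimensional_boundedBackwardOrbits hT
    by_contra hne
    obtain ⟨l, hl, hl1⟩ := exists_hasEigenvalue_one_le_norm hne
    exact (h l hl).not_ge hl1
  obtain ⟨C, hC, hTC⟩ := hT
  have hU : balancedCore ℂ (T ⁻¹' C) ∈ 𝓝 (0 : X) := balancedCore_mem_nhds_zero hTC
  exact ⟨_, hU, isVonNBounded_iUnion_image_pow_of_boundedBackwardOrbits_eq_bot hU
    (balancedCore_balanced _) hC (balancedCore_subset (T ⁻¹' C)) hbot⟩

theorem tendsToZero_nb_of_forall_hasEigenvalue_norm_lt {K : X →ₗ[ℂ] X}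
    (hK : IsCompactOperator K) {μ ν : ℝ} (hμ : 0 < μ) (hμν : μ < ν)
    (h : ∀ l, Module.End.HasEigenvalue K l → ‖l‖ < μ) :
    TendsToZero .nb fun n => ((ν : ℂ) ^ n)⁻¹ • K ^ n := by
  have hμ0 : (μ : ℂ) ≠ 0 := by exact_mod_cast hμ.ne'
  have heig (l : ℂ) (hl : Module.End.HasEigenvalue ((μ : ℂ)⁻¹ • K) l) : ‖l‖ < 1 := by
    obtain ⟨y, hy⟩ := hl.exists_hasEigenvector
    have hKy : K y = ((μ : ℂ) * l) • y := by
      rw [mul_smul, ← hy.apply_eq_smul, LinearMap.smul_apply, smul_inv_smul₀ hμ0]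
    have := h _ (Module.End.hasEigenvalue_of_hasEigenvector
      ⟨Module.End.mem_eigenspace_iff.2 hKy, hy.2⟩)
    rwa [norm_mul, Complex.norm_of_nonneg hμ.le, mul_lt_iff_lt_one_right hμ] at this
  obtain ⟨U, hU, hKU⟩ := exists_nhds_isVonNBounded_iUnion_image_pow (hK.smul (μ : ℂ)⁻¹) heig
  have hc : ‖(μ / ν : ℂ)‖ < 1 := by
    rw [norm_div, Complex.norm_of_nonneg hμ.le, Complex.norm_of_nonneg (hμ.trans hμν).le]
    exact (div_lt_one (hμ.trans hμν)).2 hμν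
  have hpow (n : ℕ) :
      (μ / ν : ℂ) ^ n • ((μ : ℂ)⁻¹ • K) ^ n = ((ν : ℂ) ^ n)⁻¹ • K ^ n := by
    rw [smul_pow, smul_smul, ← mul_pow, div_mul_eq_mul_div, mul_inv_cancel₀ hμ0, one_div, inv_pow]
  exact ⟨U, hU, by simpa only [hpow] using tendsToZeroUniformlyOn_smul_pow hKU hc⟩

end SpectralRadius

end TVSOperator

theorem mainTheorem2 {X : Type*} [AddCommGroup X] [Module ℂ X] [TopologicalSpace X]
    [IsTopologicalAddGroup X] [ContinuousSMul ℂ X] [T2Space X]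
    (K : X →ₗ[ℂ] X) (hK : IsCompactOperator K) (i j : TVSOperator.OpClass) :
    TVSOperator.spectralRadius i K ≤
      TVSOperator.geometricRadius (TVSOperator.spectrum j K) := by
  refine le_of_forall_gt_imp_ge_of_dense fun r hr => ?_
  obtain ⟨ν, hν, hνr⟩ := ENNReal.lt_iff_exists_nnreal_btwn.1 hr
  obtain ⟨μ, hμ, hμν⟩ := ENNReal.lt_iff_exists_nnreal_btwn.1 hν
  have hμ0 : (0 : ℝ) < μ := by exact_mod_cast zero_le.trans_lt hμ
  have hμν' : (μ : ℝ) < ν := by exact_mod_cast hμν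
  have heig (l : ℂ) (hl : Module.End.HasEigenvalue K l) : ‖l‖ < μ := by
    have := (TVSOperator.enorm_le_geometricRadius
      (TVSOperator.mem_spectrum_of_hasEigenvalue hl j)).trans_lt hμ
    rw [enorm_eq_nnnorm] at this
    exact_mod_cast this
  have hnb := TVSOperator.tendsToZero_nb_of_forall_hasEigenvalue_norm_lt hK hμ0 hμν' heig
  calc TVSOperator.spectralRadius i K
      ≤ ENNReal.ofReal ν := TVSOperator.spectralRadius_le_ofReal (hμ0.trans hμν') (hnb.of_nb i)
    _ = ν := ENNReal.ofReal_coe_nnreal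
    _ ≤ r := hνr.le
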